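/- Let $F$ be a probability distribution on $\mathbb{R}_+$ with density $f$, supported on an interval with endpoints $0\le \underline v<\overline v\le\infty$, where $f>0$ on $(\underline v,\overline v)$ and $f=0$ outside the interval. Let $\lambda\in[0,1)$ and suppose that $F$ is $\lambda$-regular: $v\mapsto \lambda v-\frac{1-F(v)}{f(v)}$ is non-decreasing on $(\underline v,\overline v)$. Put $c(\lambda)=(1-\lambda)^{1/\lambda}$ for $\lambda\in(0,1)$ and $c(0)=\lim_{\lambda\to0^+}c(\lambda)=\frac1e$. An intermediary represents a finite set $N$ of unit-demand buyers whose valuations $(v_i)_{i\in N}$ are i.i.d. from $F$. It knows only the prior $F$, and it can buy any number of identical items from the seller at a price $p\ge 0$ per item. A (direct) mechanism of the intermediary consists of measurable functions giving, for each profile of reports $v$ and each $i\in N$, the probability $x_i(v)\in[0,1]$ that the intermediary buys an item for buyer $i$, and a real payment $t_i(v)$ of buyer $i$ to the intermediary. The payments are integrable, also conditionally on each report of buyer $i$, all other valuations being drawn from the prior. Buyer $i$'s utility is $v_i x_i-t_i$. The mechanism is feasible if it is Bayesian incentive compatible and interim individually rational, for all valuations and reports in $[\underline v,\overline v]\cap\mathbb{R}$.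 The intermediary is a monopolist: it maximizes its expected profit $\mathbb{E}\big[\sum_{i\in N}(t_i(v)-p\,x_i(v))\big]$ over all feasible mechanisms. Then a profit-maximizing feasible mechanism exists. Moreover, for every profit-maximizing feasible mechanism $(x,t)$ and every buyer $i\in N$ with $\mathbb{P}[v_i\ge p]>0$, the probability that the intermediary buys an item for buyer $i$, conditional on $v_i\ge p$, is at least $c(\lambda)$: $$\mathbb{E}\big[x_i(v)\,\big|\,v_i\ge p\big]\ \ge\ c(\lambda).$$ In particular, for $\lambda=0$ (monotone hazard rate) this probability is at least $\frac1e$. -/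

import Mathlib

open MeasureTheory ProbabilityTheory

namespace Intermediary

/-- The type space of a buyer: the real points of the interval `[lo, hi]`; `hi = ⊤` is allowed. -/
def typeSpace (lo : ℝ) (hi : EReal) : Set ℝ := {v | lo ≤ v ∧ (v : EReal) ≤ hi}

/-- The interior of the type space. -/
def typeInterior (lo : ℝ) (hi : EReal) : Set ℝ := {v | lo < v ∧ (v : EReal) < hi}

/-- `μ` is a valuation distribution with density `f`, supported on the interval from `lo` to `hi`
(`0 ≤ lo < hi ≤ ∞`); the density is positive on the interior and zero outside the interval. -/
structure IsPrior (μ : Measure ℝ) (f : ℝ → ℝ) (lo : ℝ) (hi : EReal) : Prop where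
  lo_nonneg : 0 ≤ lo
  lo_lt_hi : (lo : EReal) < hi
  measurable_density : Measurable f
  density_pos : ∀ v ∈ typeInterior lo hi, 0 < f v
  density_zero : ∀ v, v ∉ typeSpace lo hi → f v = 0
  eq_withDensity : μ = volume.withDensity (fun v => ENNReal.ofReal (f v))

/-- `lam`-regularity: `lam * v - (1 - F v) / f v` is non-decreasing, where `F` is the distribution
function. For `lam = 0` this is the monotone hazard rate condition; for `lam = 1` it is Myerson
regularity. -/
def IsLambdaRegular (lam : ℝ) (μ : Measure ℝ) (f : ℝ → ℝ) (lo : ℝ) (hi : EReal) : Prop :=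
  MonotoneOn (fun v => lam * v - (1 - cdf μ v) / f v) (typeInterior lo hi)

/-- `c lam = (1 - lam) ^ (1 / lam)`, extended by its limit `1 / e` at `lam = 0`. -/
noncomputable def c (lam : ℝ) : ℝ :=
  if lam = 0 then 1 / Real.exp 1 else (1 - lam) ^ (1 / lam)

/-- The value at `0` is the limit of `c` from the right. -/
theorem tendsto_c_zero : Filter.Tendsto c (nhdsWithin 0 (Set.Ioi 0)) (nhds (c 0)) := by
  have h := (Real.tendsto_one_add_div_rpow_exp (-1)).comp tendsto_inv_nhdsGT_zero
  have h0 : c 0 = Real.exp (-1) := by simp [c, Real.exp_neg]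
  rw [h0]
  refine h.congr' ?_
  filter_upwards [self_mem_nhdsWithin] with x hx
  have hx0 : x ≠ 0 := ne_of_gt hx
  simp [c, hx0, sub_eq_add_neg]

/-- A direct mechanism of the intermediary for the set `ι` of buyers that it represents. At the
report profile `v`, `alloc v i` is the probability (over the randomization of the mechanism) that
the intermediary buys an item for buyer `i`, and `pay v i` is the (expected) payment of `i` to the
intermediary. -/
structure Mechanism (ι : Type*) where
  alloc : (ι → ℝ) → ι → ℝ
  pay : (ι → ℝ) → ι → ℝ

section

variable {ι : Type*} [Fintype ι]

/-- The joint law of the valuations: independent draws from `μ`. -/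
noncomputable def valuationLaw (ι : Type*) [Fintype ι] (μ : Measure ℝ) : Measure (ι → ℝ) :=
  Measure.pi (fun _ : ι => μ)

/-- The interim utility of buyer `i` with value `v` who reports `r`, while the other buyers
report their valuations, which are drawn from the prior (coordinate `i` of the integration variable
is overwritten by `r`). -/
noncomputable def interimUtility [DecidableEq ι] (μ : Measure ℝ) (M : Mechanism ι) (i : ι)
    (v r : ℝ) : ℝ :=
  ∫ w, (v * M.alloc (Function.update w i r) i - M.pay (Function.update w i r) i)
    ∂(valuationLaw ι μ)

/-- The mechanisms available to an intermediary that only knows the prior: each buyer gets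
at most one item, truthful reporting is Bayesian incentive compatible, and participation is
interim individually rational. -/
structure IsFeasible [DecidableEq ι] (μ : Measure ℝ) (lo : ℝ) (hi : EReal) (M : Mechanism ι) :
    Prop where
  measurable_alloc : ∀ i, Measurable (fun v => M.alloc v i)
  measurable_pay : ∀ i, Measurable (fun v => M.pay v i)
  alloc_mem : ∀ v : ι → ℝ, (∀ j, v j ∈ typeSpace lo hi) → ∀ i, M.alloc v i ∈ Set.Icc (0 : ℝ) 1
  integrable_pay : ∀ i, Integrable (fun v => M.pay v i) (valuationLaw ι μ)
  integrable_interim_pay : ∀ i, ∀ r ∈ typeSpace lo hi,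
    Integrable (fun w => M.pay (Function.update w i r) i) (valuationLaw ι μ)
  incentive_compatible : ∀ i, ∀ v ∈ typeSpace lo hi, ∀ r ∈ typeSpace lo hi,
    interimUtility μ M i v r ≤ interimUtility μ M i v v
  individually_rational : ∀ i, ∀ v ∈ typeSpace lo hi, 0 ≤ interimUtility μ M i v v

/-- Expected profit of the intermediary when it pays the seller `p` for each item it buys. -/
noncomputable def profit (μ : Measure ℝ) (p : ℝ) (M : Mechanism ι) : ℝ :=
  ∫ v, ∑ i, (M.pay v i - p * M.alloc v i) ∂(valuationLaw ι μ)

/-- `M` is a profit-maximizing mechanism of a monopolist intermediary facing the per-item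
price `p`. -/
def IsProfitMaximizing [DecidableEq ι] (μ : Measure ℝ) (lo : ℝ) (hi : EReal) (p : ℝ)
    (M : Mechanism ι) : Prop :=
  IsFeasible μ lo hi M ∧ ∀ M' : Mechanism ι, IsFeasible μ lo hi M' → profit μ p M' ≤ profit μ p M

/-- The probability that the intermediary buys an item for buyer `i`, conditional on
buyer `i` having valuation at least `p`. -/
noncomputable def condBuyProb (μ : Measure ℝ) (p : ℝ) (M : Mechanism ι) (i : ι) : ℝ :=
  ∫ v, M.alloc v i ∂(cond (valuationLaw ι μ) {v | p ≤ v i})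

end

end Intermediary

/-! Items are unlimited at price `p`, so no constraint couples the buyers and the problem splits
into single-buyer problems for the interim allocations. Write `h = (1 - F) / f` for the inverse
hazard rate. Incentive compatibility makes the interim allocation a subgradient of the truthful
interim utility; the envelope formula and an exchange of integrals then give the profit as the
expectation of `(v - h v - p) * X v`, minus the utility of the lowest type.

Regularity with `lam < 1` says that `h` grows with slope at most `lam`. Hence `h` and `v` are
integrable, and the virtual value `v - h v` is strictly increasing, so it crosses `p` at a cutoff
`q`. Posting `q` maximizes the integrand almost everywhere, which gives existence; since the virtual
value equals `p` at most once, every optimal mechanism has interim allocation `1_{v ≥ q}` almost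
surely. The conditional probability is therefore `P[v ≥ max p q] / P[v ≥ p]`.

It remains to bound this ratio when `p < q`. At the cutoff `h` is at least `d = q - p`, so going
back with slope at most `lam` gives `h v ≥ (1 - lam) * d + lam * (v - p)` on the relevant part of
`[p, q)`. The tail `G = 1 - F` satisfies `-G' = f = G / h`, and Grönwall compares it with the case
of equality, whose solution loses exactly the factor `c lam` between `p` and `q`. The proof rests on
`integral_profit_eq`, `exists_cutoff`, `c_mul_le` and `ae_virtual_ne`. -/

namespace Intermediary

/-! ### The prior and its inverse hazard rate -/

/-- The inverse hazard rate `(1 - F) / f`. -/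
noncomputable def invHazard (μ : Measure ℝ) (f : ℝ → ℝ) (v : ℝ) : ℝ := (1 - cdf μ v) / f v

theorem typeInterior_subset_typeSpace (lo : ℝ) (hi : EReal) :
    typeInterior lo hi ⊆ typeSpace lo hi := fun _ h => ⟨h.1.le, h.2.le⟩

theorem typeSpace_diff_typeInterior_subset (lo : ℝ) (hi : EReal) :
    typeSpace lo hi \ typeInterior lo hi ⊆ {lo, hi.toReal} := by
  rintro v ⟨h1, h2⟩
  by_cases h : lo = v
  · exact Or.inl h.symm
  · have h3 : lo < v := lt_of_le_of_ne h1.1 h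
    have h4 : hi = (v : EReal) := by
      refine le_antisymm (not_lt.1 fun h5 => h2 ⟨h3, h5⟩) h1.2
    right
    simp [h4]

theorem ordConnected_typeSpace (lo : ℝ) (hi : EReal) : (typeSpace lo hi).OrdConnected :=
  ⟨fun _ ha _ hb _ hx =>
    ⟨ha.1.trans hx.1, (EReal.coe_le_coe_iff.2 hx.2).trans hb.2⟩⟩

theorem measurableSet_typeSpace (lo : ℝ) (hi : EReal) : MeasurableSet (typeSpace lo hi) :=
  (ordConnected_typeSpace lo hi).measurableSet

namespace IsPrior

variable {μ : Measure ℝ} {f : ℝ → ℝ} {lo : ℝ} {hi : EReal}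

theorem noAtoms (h : IsPrior μ f lo hi) : NullSingletonClass μ := by
  rw [h.eq_withDensity]; infer_instance

theorem lo_mem (h : IsPrior μ f lo hi) : lo ∈ typeSpace lo hi := ⟨le_rfl, h.lo_lt_hi.le⟩

theorem exists_mem_typeInterior (h : IsPrior μ f lo hi) : ∃ v, v ∈ typeInterior lo hi := by
  obtain ⟨v, h1, h2⟩ := EReal.lt_iff_exists_real_btwn.1 h.lo_lt_hi
  exact ⟨v, EReal.coe_lt_coe_iff.1 h1, h2⟩

theorem measure_compl_typeSpace (h : IsPrior μ f lo hi) : μ (typeSpace lo hi)ᶜ = 0 := by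
  rw [h.eq_withDensity, withDensity_apply _ (measurableSet_typeSpace lo hi).compl]
  rw [setLIntegral_congr_fun (g := fun _ => 0) (measurableSet_typeSpace lo hi).compl]
  · simp
  · intro v hv
    simp [h.density_zero v hv]

theorem ae_mem_typeInterior (h : IsPrior μ f lo hi) : ∀ᵐ v ∂μ, v ∈ typeInterior lo hi := by
  have := h.noAtoms
  have h1 : ∀ᵐ v ∂μ, v ∈ typeSpace lo hi := h.measure_compl_typeSpace
  have h2 : ∀ᵐ v ∂μ, v ∉ ({lo, hi.toReal} : Set ℝ) :=
    measure_eq_zero_iff_ae_notMem.1 ((Set.toFinite _).measure_zero μ)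
  filter_upwards [h1, h2] with v h1 h2
  by_contra h3
  exact h2 (typeSpace_diff_typeInterior_subset lo hi ⟨h1, h3⟩)

theorem one_sub_cdf [IsProbabilityMeasure μ] (h : IsPrior μ f lo hi) (v : ℝ) :
    1 - cdf μ v = μ.real (Set.Ici v) := by
  have := h.noAtoms
  rw [cdf_eq_real, ← probReal_compl_eq_one_sub measurableSet_Iic, Set.compl_Iic,
    measureReal_congr Ioi_ae_eq_Ici]

theorem measurable_invHazard (h : IsPrior μ f lo hi) : Measurable (invHazard μ f) :=
  (measurable_const.sub (monotone_cdf μ).measurable).div h.measurable_density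

theorem invHazard_nonneg (h : IsPrior μ f lo hi) {v : ℝ} (hv : v ∈ typeInterior lo hi) :
    0 ≤ invHazard μ f v :=
  div_nonneg (sub_nonneg.2 (cdf_le_one μ v)) (h.density_pos v hv).le

theorem ofReal_mul_invHazard [IsProbabilityMeasure μ] (h : IsPrior μ f lo hi) {v : ℝ}
    (hv : v ∈ typeInterior lo hi) :
    ENNReal.ofReal (f v) * ENNReal.ofReal (invHazard μ f v) = μ (Set.Ici v) := by
  have hf := h.density_pos v hv
  rw [← ENNReal.ofReal_mul hf.le, invHazard, mul_div_cancel₀ _ hf.ne', h.one_sub_cdf,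
    ofReal_measureReal]

/-- The density cancels against the denominator of the inverse hazard rate, leaving the tail
probability. Beyond `hi` the tail vanishes together with the density; the endpoints, where `f` is
not controlled, are Lebesgue-null. -/
theorem lintegral_mul_invHazard [IsProbabilityMeasure μ] (h : IsPrior μ f lo hi)
    {g : ℝ → ENNReal} (hg : Measurable g) :
    ∫⁻ v, g v * ENNReal.ofReal (invHazard μ f v) ∂μ
      = ∫⁻ s in Set.Ioi lo, g s * μ (Set.Ici s) := by
  have hm := h.measurable_invHazard
  have hf := h.measurable_density
  rw [← lintegral_indicator measurableSet_Ioi]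
  have key := lintegral_withDensity_eq_lintegral_mul volume
    (f := fun v => ENNReal.ofReal (f v)) (by fun_prop)
    (g := fun v => g v * ENNReal.ofReal (invHazard μ f v)) (by fun_prop)
  rw [← h.eq_withDensity] at key
  rw [key]
  have h2 : ∀ᵐ v : ℝ, v ∉ ({lo, hi.toReal} : Set ℝ) :=
    measure_eq_zero_iff_ae_notMem.1 ((Set.toFinite _).measure_zero volume)
  refine lintegral_congr_ae ?_
  filter_upwards [h2] with v h2
  simp only [Pi.mul_apply]
  by_cases hv : v ∈ typeInterior lo hi
  · rw [Set.indicator_of_mem (show v ∈ Set.Ioi lo from hv.1), mul_left_comm,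
      h.ofReal_mul_invHazard hv]
  · have hv' : v ∉ typeSpace lo hi := fun h' =>
      h2 (typeSpace_diff_typeInterior_subset lo hi ⟨h', hv⟩)
    rw [h.density_zero v hv']
    by_cases hlo : lo < v
    · have : μ (Set.Ici v) = 0 := by
        refine measure_mono_null ?_ h.measure_compl_typeSpace
        intro s hs hs'
        refine hv' ⟨hlo.le, ?_⟩
        exact (EReal.coe_le_coe_iff.2 hs).trans hs'.2
      simp [this, Set.indicator]
    · simp [hlo]

/-- Exchange of the order of integration. -/
theorem lintegral_lintegral_Ioc [IsProbabilityMeasure μ] (h : IsPrior μ f lo hi)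
    {g : ℝ → ENNReal} (hg : Measurable g) :
    ∫⁻ v, (∫⁻ s in Set.Ioc lo v, g s) ∂μ = ∫⁻ v, g v * ENNReal.ofReal (invHazard μ f v) ∂μ := by
  rw [h.lintegral_mul_invHazard hg]
  have h1 : ∀ v, ∫⁻ s in Set.Ioc lo v, g s
      = ∫⁻ s in Set.Ioi lo, Set.indicator {q : ℝ × ℝ | q.2 ≤ q.1} (fun q => g q.2) (v, s) := by
    intro v
    rw [← lintegral_indicator measurableSet_Ioi, ← lintegral_indicator measurableSet_Ioc]
    congr 1 with s
    by_cases h1 : lo < s <;> by_cases h2 : s ≤ v <;> simp [Set.indicator, h1, h2]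
  simp_rw [h1]
  rw [lintegral_lintegral_swap]
  · congr 1 with s
    have : ∀ v, Set.indicator {q : ℝ × ℝ | q.2 ≤ q.1} (fun q => g q.2) (v, s)
        = (Set.Ici s).indicator (fun _ => g s) v := by
      intro v; simp [Set.indicator]
    simp_rw [this]
    rw [lintegral_indicator_const measurableSet_Ici]
  · refine Measurable.aemeasurable ?_
    exact (hg.comp measurable_snd).indicator (measurableSet_le measurable_snd measurable_fst)

end IsPrior

/-! ### Integrability from regularity -/

/-- The form in which regularity is used throughout: a one-sided slope bound on the inverse hazard
rate. -/
theorem IsLambdaRegular.le_add {lam : ℝ} {μ : Measure ℝ} {f : ℝ → ℝ} {lo : ℝ} {hi : EReal}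
    (hreg : IsLambdaRegular lam μ f lo hi) {a b : ℝ} (ha : a ∈ typeInterior lo hi)
    (hb : b ∈ typeInterior lo hi) (hab : a ≤ b) :
    invHazard μ f b ≤ invHazard μ f a + lam * (b - a) := by
  have := hreg ha hb hab
  simp only at this
  unfold invHazard
  linarith

namespace IsPrior

variable {μ : Measure ℝ} {f : ℝ → ℝ} {lo : ℝ} {hi : EReal}

theorem setLIntegral_Iic_invHazard [IsProbabilityMeasure μ] (h : IsPrior μ f lo hi) (M : ℝ) :
    ∫⁻ v in Set.Iic M, ENNReal.ofReal (invHazard μ f v) ∂μ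
      = ∫⁻ v, ENNReal.ofReal (min v M - lo) ∂μ := by
  have h1 := h.lintegral_lintegral_Ioc
    (g := (Set.Iic M).indicator 1) (measurable_one.indicator measurableSet_Iic)
  rw [← lintegral_indicator measurableSet_Iic]
  trans ∫⁻ v, (Set.Iic M).indicator 1 v * ENNReal.ofReal (invHazard μ f v) ∂μ
  · congr 1 with v
    by_cases hv : v ≤ M <;> simp [Set.indicator, hv]
  · rw [← h1]
    congr 1 with v
    rw [lintegral_indicator_one measurableSet_Iic, Measure.restrict_apply measurableSet_Iic,
      Set.inter_comm, Set.Ioc_inter_Iic, Real.volume_Ioc]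

/-- Truncated at `M`, the integral `J M` equals the mean of `min v M - lo`. Past a fixed interior
point `a` the integrand is at most `invHazard μ f a + lam * (v - lo)`, so `J M ≤ C + lam * J M`. As
`J M` is finite and `lam < 1`, the last term can be absorbed, uniformly in `M`. -/
theorem lintegral_invHazard_lt_top [IsProbabilityMeasure μ] (h : IsPrior μ f lo hi) {lam : ℝ}
    (hlam : 0 ≤ lam) (hlam1 : lam < 1) (hreg : IsLambdaRegular lam μ f lo hi) :
    ∫⁻ v, ENNReal.ofReal (invHazard μ f v) ∂μ < ⊤ := by
  obtain ⟨a, ha⟩ := h.exists_mem_typeInterior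
  have hm := h.measurable_invHazard
  set J : ℝ → ENNReal := fun M => ∫⁻ v in Set.Iic M, ENNReal.ofReal (invHazard μ f v) ∂μ with hJ
  set C := (a - lo) + invHazard μ f a with hC
  have hC0 : 0 ≤ C := add_nonneg (sub_nonneg.2 ha.1.le) (h.invHazard_nonneg ha)
  have hfin : ∀ M, J M ≤ ENNReal.ofReal (M - lo) := by
    intro M
    simp only [hJ]
    rw [h.setLIntegral_Iic_invHazard]
    calc _ ≤ ∫⁻ _, ENNReal.ofReal (M - lo) ∂μ := by
          gcongr; exact min_le_right _ _
      _ = _ := by simp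
  have hrec : ∀ M, J M ≤ ENNReal.ofReal C + ENNReal.ofReal lam * J M := by
    intro M
    have e1 : J M ≤ J a + ∫⁻ v in Set.Iic M ∩ Set.Ioi a, ENNReal.ofReal (invHazard μ f v) ∂μ := by
      refine (lintegral_inter_add_sdiff (f := fun v => ENNReal.ofReal (invHazard μ f v)) (μ := μ)
        (A := Set.Iic M) (B := Set.Iic a) measurableSet_Iic).symm.trans_le ?_
      refine add_le_add (lintegral_mono_set Set.inter_subset_right) (lintegral_mono_set ?_)
      rintro v ⟨h1, h2⟩
      exact ⟨h1, Set.mem_Ioi.2 (lt_of_not_ge h2)⟩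
    have e2 : ∫⁻ v in Set.Iic M ∩ Set.Ioi a, ENNReal.ofReal (invHazard μ f v) ∂μ
        ≤ ENNReal.ofReal (invHazard μ f a) + ENNReal.ofReal lam * J M := by
      simp only [hJ]
      rw [h.setLIntegral_Iic_invHazard, ← lintegral_const_mul _ (by fun_prop),
        ← lintegral_indicator (measurableSet_Iic.inter measurableSet_Ioi)]
      calc _ ≤ ∫⁻ v, (ENNReal.ofReal (invHazard μ f a)
            + ENNReal.ofReal lam * ENNReal.ofReal (min v M - lo)) ∂μ := by
            refine lintegral_mono_ae ?_
            filter_upwards [h.ae_mem_typeInterior] with v hv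
            by_cases hvM : v ∈ Set.Iic M ∩ Set.Ioi a
            · have hva : a < v := hvM.2
              have hvM' : v ≤ M := hvM.1
              rw [Set.indicator_of_mem hvM, ← ENNReal.ofReal_mul hlam,
                ← ENNReal.ofReal_add (h.invHazard_nonneg ha) (mul_nonneg hlam _)]
              · refine ENNReal.ofReal_le_ofReal ((hreg.le_add ha hv hva.le).trans ?_)
                rw [min_eq_left hvM']
                have := ha.1
                gcongr
              · rw [min_eq_left hvM']
                linarith [hv.1]
            · rw [Set.indicator_of_notMem hvM]
              exact zero_le
        _ = _ := by
            rw [lintegral_add_left measurable_const]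
            simp
    calc J M ≤ ENNReal.ofReal (a - lo)
          + (ENNReal.ofReal (invHazard μ f a) + ENNReal.ofReal lam * J M) :=
          e1.trans (add_le_add (hfin a) e2)
      _ = _ := by
          rw [hC, ENNReal.ofReal_add (sub_nonneg.2 ha.1.le) (h.invHazard_nonneg ha), add_assoc]
  have hbd : ∀ M, J M ≤ ENNReal.ofReal (C / (1 - lam)) := by
    intro M
    have hne : J M ≠ ⊤ := ((hfin M).trans_lt ENNReal.ofReal_lt_top).ne
    have h1 := hrec M
    obtain ⟨x, hx⟩ : ∃ x, x = (J M).toReal := ⟨_, rfl⟩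
    have hx0 : 0 ≤ x := hx ▸ ENNReal.toReal_nonneg
    have hJx : J M = ENNReal.ofReal x := by rw [hx, ENNReal.ofReal_toReal hne]
    rw [hJx, ← ENNReal.ofReal_mul hlam, ← ENNReal.ofReal_add hC0 (by positivity),
      ENNReal.ofReal_le_ofReal_iff (by positivity)] at h1
    rw [hJx]
    refine ENNReal.ofReal_le_ofReal ?_
    rw [le_div_iff₀ (by linarith)]
    linarith
  have hU : (⋃ n : ℕ, Set.Iic (n : ℝ)) = Set.univ := by
    refine Set.eq_univ_of_forall fun x => ?_
    obtain ⟨n, hn⟩ := exists_nat_ge x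
    exact Set.mem_iUnion.2 ⟨n, hn⟩
  rw [← setLIntegral_univ, ← hU, setLIntegral_iUnion_of_directed]
  · exact (iSup_le fun n : ℕ => hbd n).trans_lt ENNReal.ofReal_lt_top
  · exact Monotone.directed_le fun m n hmn => Set.Iic_subset_Iic.2 (Nat.cast_le.2 hmn)

theorem integrable_invHazard [IsProbabilityMeasure μ] (h : IsPrior μ f lo hi) {lam : ℝ}
    (hlam : 0 ≤ lam) (hlam1 : lam < 1) (hreg : IsLambdaRegular lam μ f lo hi) :
    Integrable (invHazard μ f) μ := by
  refine (lintegral_ofReal_ne_top_iff_integrable h.measurable_invHazard.aestronglyMeasurable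
    ?_).1 (h.lintegral_invHazard_lt_top hlam hlam1 hreg).ne
  filter_upwards [h.ae_mem_typeInterior] with v hv using h.invHazard_nonneg hv

/-- A finite mean is not assumed: exchanging integrals with `g = 1` identifies the mean of `v - lo`
with that of the inverse hazard rate. -/
theorem integrable_id [IsProbabilityMeasure μ] (h : IsPrior μ f lo hi) {lam : ℝ}
    (hlam : 0 ≤ lam) (hlam1 : lam < 1) (hreg : IsLambdaRegular lam μ f lo hi) :
    Integrable (fun v => v) μ := by
  have h1 : Integrable (fun v => v - lo) μ := by
    refine (lintegral_ofReal_ne_top_iff_integrable (by fun_prop) ?_).1 ?_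
    · filter_upwards [h.ae_mem_typeInterior] with v hv using sub_nonneg.2 hv.1.le
    · have h2 := h.lintegral_lintegral_Ioc (g := fun _ => 1) measurable_const
      simp only [lintegral_const, one_mul, Measure.restrict_apply_univ, Real.volume_Ioc] at h2
      rw [h2]
      exact (h.lintegral_invHazard_lt_top hlam hlam1 hreg).ne
  simpa [Pi.add_def] using h1.add (integrable_const lo)

end IsPrior

/-! ### The envelope formula -/

/-- Add the inequality for `(v, r)` to the one for `(r, v)`. In the application `U` is the truthful
utility, `X` the allocation, and the hypothesis is incentive compatibility. -/
theorem monotoneOn_of_subgradient {X U : ℝ → ℝ} {s : Set ℝ}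
    (h : ∀ v ∈ s, ∀ r ∈ s, U r + (v - r) * X r ≤ U v) : MonotoneOn X s := by
  intro r hr v hv hrv
  rcases hrv.eq_or_lt with rfl | hlt
  · rfl
  have h1 := h v hv r hr
  have h2 := h r hr v hv
  have : 0 ≤ (v - r) * (X v - X r) := by linarith
  exact sub_nonneg.1 (nonneg_of_mul_nonneg_right this (sub_pos.2 hlt))

/-- The increment of `U` lies between `(y - x) * X x` and `(y - x) * X y`. This makes `U`
differentiable wherever `X` is continuous. -/
theorem abs_sub_sub_le_of_subgradient {X U : ℝ → ℝ} {s : Set ℝ}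
    (h : ∀ v ∈ s, ∀ r ∈ s, U r + (v - r) * X r ≤ U v) {x y : ℝ} (hx : x ∈ s) (hy : y ∈ s) :
    |U y - U x - (y - x) * X x| ≤ |X y - X x| * |y - x| := by
  have h1 := h y hy x hx
  have h2 := h x hx y hy
  rw [← abs_mul, abs_of_nonneg (by linarith)]
  refine le_trans ?_ (le_abs_self _)
  linarith

/-- The envelope formula: a function is the integral of a selection of its subgradients. -/
theorem integral_subgradient {X U : ℝ → ℝ} {a b : ℝ} (hab : a ≤ b)
    (h : ∀ v ∈ Set.Icc a b, ∀ r ∈ Set.Icc a b, U r + (v - r) * X r ≤ U v) :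
    ∫ x in a..b, X x = U b - U a := by
  have hmono := monotoneOn_of_subgradient h
  have hderiv : ∀ x ∈ Set.Ioo a b, ContinuousWithinAt X (Set.Icc a b) x →
      HasDerivAt U (X x) x := by
    intro x hx hc
    have hnhds : Set.Icc a b ∈ nhds x := Icc_mem_nhds hx.1 hx.2
    have hc' : ContinuousAt X x := hc.continuousAt hnhds
    rw [hasDerivAt_iff_isLittleO, Asymptotics.isLittleO_iff]
    intro ε hε
    filter_upwards [hnhds, Metric.continuousAt_iff'.1 hc' ε hε] with y hy hXy
    rw [Real.dist_eq] at hXy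
    rw [Real.norm_eq_abs, Real.norm_eq_abs, smul_eq_mul]
    exact (abs_sub_sub_le_of_subgradient h ⟨hx.1.le, hx.2.le⟩ hy).trans (by gcongr)
  -- The monotone `X` is bounded by its endpoint values, so `U` is Lipschitz.
  have hcont : ContinuousOn U (Set.Icc a b) := by
    have hX : ∀ x ∈ Set.Icc a b, |X x| ≤ max |X a| |X b| := fun x hx =>
      abs_le_max_abs_abs (hmono (Set.left_mem_Icc.2 hab) hx hx.1)
        (hmono hx (Set.right_mem_Icc.2 hab) hx.2)
    have hL : LipschitzOnWith (Real.toNNReal (max |X a| |X b|)) U (Set.Icc a b) := by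
      refine LipschitzOnWith.of_dist_le_mul fun x hx y hy => ?_
      rw [Real.dist_eq, Real.dist_eq, Real.coe_toNNReal _ (le_max_of_le_left (abs_nonneg _))]
      have h1 := h y hy x hx
      have h2 := h x hx y hy
      have h3 : (x - y) * X x ≤ max |X a| |X b| * |x - y| := by
        refine (le_abs_self _).trans ?_
        rw [abs_mul, mul_comm]
        gcongr
        exact hX x hx
      have h4 : -(max |X a| |X b| * |x - y|) ≤ (x - y) * X y := by
        refine le_trans ?_ (neg_abs_le _)
        rw [abs_mul, mul_comm |x - y|]
        gcongr
        exact hX y hy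
      rw [abs_le]
      constructor <;> linarith
    exact hL.continuousOn
  -- A monotone function has only countably many discontinuities, and the fundamental theorem of
  -- calculus tolerates these.
  refine integral_eq_of_hasDerivAt_off_countable_of_le U X hab
    hmono.countable_not_continuousWithinAt hcont ?_ ?_
  · rintro x ⟨hx, hx'⟩
    refine hderiv x hx ?_
    by_contra hc
    exact hx' ⟨⟨hx.1.le, hx.2.le⟩, hc⟩
  · rw [← Set.uIcc_of_le hab] at hmono
    exact hmono.intervalIntegrable

/-! ### Virtual values and the cutoff -/

namespace IsPrior

variable {μ : Measure ℝ} {f : ℝ → ℝ} {lo : ℝ} {hi : EReal}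

theorem integrable_virtual_mul [IsProbabilityMeasure μ] (h : IsPrior μ f lo hi) {lam : ℝ}
    (hlam : 0 ≤ lam) (hlam1 : lam < 1) (hreg : IsLambdaRegular lam μ f lo hi) {X : ℝ → ℝ}
    (hX : Measurable X) (hX01 : ∀ v ∈ typeSpace lo hi, X v ∈ Set.Icc (0 : ℝ) 1) (p : ℝ) :
    Integrable (fun v => (v - invHazard μ f v - p) * X v) μ := by
  refine (((h.integrable_id hlam hlam1 hreg).sub
    (h.integrable_invHazard hlam hlam1 hreg)).sub (integrable_const p)).mul_bdd (c := 1)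
    hX.aestronglyMeasurable ?_
  filter_upwards [h.ae_mem_typeInterior] with v hv
  have := hX01 v (typeInterior_subset_typeSpace lo hi hv)
  rw [Real.norm_eq_abs, abs_of_nonneg this.1]
  exact this.2

/-- Expected profit of an incentive compatible single-buyer mechanism, by virtual values. -/
theorem integral_profit_eq [IsProbabilityMeasure μ] (h : IsPrior μ f lo hi) {lam : ℝ}
    (hlam : 0 ≤ lam) (hlam1 : lam < 1) (hreg : IsLambdaRegular lam μ f lo hi) {X T : ℝ → ℝ}
    (hX : Measurable X) (hT : Measurable T)
    (hX01 : ∀ v ∈ typeSpace lo hi, X v ∈ Set.Icc (0 : ℝ) 1)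
    (hIC : ∀ v ∈ typeSpace lo hi, ∀ r ∈ typeSpace lo hi, v * X r - T r ≤ v * X v - T v) (p : ℝ) :
    ∫ v, (T v - p * X v) ∂μ
      = ∫ v, (v - invHazard μ f v - p) * X v ∂μ - (lo * X lo - T lo) := by
  set D : ℝ → ℝ := fun v => (v * X v - T v) - (lo * X lo - T lo) with hD
  have hDm : Measurable D := by fun_prop
  have hae := h.ae_mem_typeInterior
  have hD0 : ∀ v ∈ typeSpace lo hi, 0 ≤ D v := by
    intro v hv
    have h1 := hIC v hv lo h.lo_mem
    have h2 := mul_nonneg (sub_nonneg.2 hv.1) (hX01 lo h.lo_mem).1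
    simp only [hD]
    linarith
  have hDint : ∀ v ∈ typeSpace lo hi,
      ENNReal.ofReal (D v) = ∫⁻ s in Set.Ioc lo v, ENNReal.ofReal (X s) := by
    intro v hv
    have hsub : Set.Icc lo v ⊆ typeSpace lo hi :=
      (ordConnected_typeSpace lo hi).out h.lo_mem hv
    have h1 := integral_subgradient (X := X) (U := fun v => v * X v - T v) hv.1
      (fun w hw r hr => by
        have := hIC w (hsub hw) r (hsub hr)
        linarith)
    rw [show D v = _ from h1.symm, intervalIntegral.integral_of_le hv.1, ofReal_integral_eq_lintegral_ofReal]
    · refine Measure.integrableOn_of_bounded (M := 1) (by simp) hX.aestronglyMeasurable ?_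
      filter_upwards [ae_restrict_mem measurableSet_Ioc] with s hs
      have := hX01 s (hsub ⟨hs.1.le, hs.2⟩)
      rw [Real.norm_eq_abs, abs_of_nonneg this.1]
      exact this.2
    · filter_upwards [ae_restrict_mem measurableSet_Ioc] with s hs
      exact (hX01 s (hsub ⟨hs.1.le, hs.2⟩)).1
  have hYm := h.measurable_invHazard
  have hYX : Integrable (fun v => X v * invHazard μ f v) μ := by
    refine (h.integrable_invHazard hlam hlam1 hreg).bdd_mul (c := 1) hX.aestronglyMeasurable ?_
    filter_upwards [hae] with v hv
    have := hX01 v (typeInterior_subset_typeSpace lo hi hv)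
    rw [Real.norm_eq_abs, abs_of_nonneg this.1]
    exact this.2
  have hYX0 : ∀ᵐ v ∂μ, 0 ≤ X v * invHazard μ f v := by
    filter_upwards [hae] with v hv
    exact mul_nonneg (hX01 v (typeInterior_subset_typeSpace lo hi hv)).1 (h.invHazard_nonneg hv)
  -- The mean information rent `D` equals the mean of `X * invHazard`: integrate the envelope
  -- formula and exchange the integrals with `g = X`.
  have hlint : ∫⁻ v, ENNReal.ofReal (D v) ∂μ
      = ∫⁻ v, ENNReal.ofReal (X v * invHazard μ f v) ∂μ := by
    trans ∫⁻ v, (∫⁻ s in Set.Ioc lo v, ENNReal.ofReal (X s)) ∂μ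
    · refine lintegral_congr_ae ?_
      filter_upwards [hae] with v hv using hDint v (typeInterior_subset_typeSpace lo hi hv)
    · rw [h.lintegral_lintegral_Ioc (by fun_prop)]
      refine lintegral_congr_ae ?_
      filter_upwards [hae] with v hv
      rw [ENNReal.ofReal_mul (hX01 v (typeInterior_subset_typeSpace lo hi hv)).1]
  have hDnonneg : ∀ᵐ v ∂μ, 0 ≤ D v := by
    filter_upwards [hae] with v hv using hD0 v (typeInterior_subset_typeSpace lo hi hv)
  have hDi : Integrable D μ := by
    refine (lintegral_ofReal_ne_top_iff_integrable hDm.aestronglyMeasurable hDnonneg).1 ?_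
    rw [hlint]
    exact (lintegral_ofReal_ne_top_iff_integrable hYX.aestronglyMeasurable hYX0).2 hYX
  have hDeq : ∫ v, D v ∂μ = ∫ v, X v * invHazard μ f v ∂μ := by
    rw [integral_eq_lintegral_of_nonneg_ae hDnonneg hDm.aestronglyMeasurable,
      integral_eq_lintegral_of_nonneg_ae hYX0 hYX.aestronglyMeasurable, hlint]
  have hV := h.integrable_virtual_mul hlam hlam1 hreg hX hX01 p
  have e1 : ∀ v, T v - p * X v = ((v - invHazard μ f v - p) * X v + X v * invHazard μ f v - D v)
      - (lo * X lo - T lo) := by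
    intro v
    simp only [hD]
    ring
  have hVY : Integrable (fun v => (v - invHazard μ f v - p) * X v + X v * invHazard μ f v) μ :=
    hV.add hYX
  have hVYD : Integrable
      (fun v => (v - invHazard μ f v - p) * X v + X v * invHazard μ f v - D v) μ := hVY.sub hDi
  simp_rw [e1]
  rw [integral_sub hVYD (integrable_const _), integral_sub hVY hDi,
    integral_add hV hYX, hDeq]
  simp

/-- The cutoff at which the virtual value crosses the price. -/
theorem exists_cutoff (h : IsPrior μ f lo hi) {lam : ℝ} (hlam1 : lam < 1)
    (hreg : IsLambdaRegular lam μ f lo hi) (p : ℝ) :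
    ∃ q, lo ≤ q ∧ (∀ v, lo < v → v < q → v ∈ typeInterior lo hi ∧ v - invHazard μ f v < p) ∧
      ∀ v ∈ typeInterior lo hi, q < v → p ≤ v - invHazard μ f v := by
  set S : Set ℝ := {v | v ∈ typeInterior lo hi ∧ v - invHazard μ f v < p} with hS
  by_cases hne : S.Nonempty
  swap
  · refine ⟨lo, le_rfl, fun v h1 h2 => absurd h1 h2.not_gt, fun v hv _ => ?_⟩
    by_contra hc
    exact hne ⟨v, hv, not_le.1 hc⟩
  obtain ⟨a, ha⟩ := h.exists_mem_typeInterior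
  have hbdd : BddAbove S := by
    -- Beyond `a` the virtual value is at least `v - invHazard μ f a - lam * (v - a)`; the witness
    -- is where this reaches `p`.
    refine ⟨max a ((invHazard μ f a + p - lam * a) / (1 - lam)), fun v hv => ?_⟩
    rcases le_total v a with hva | hva
    · exact le_max_of_le_left hva
    · refine le_max_of_le_right ?_
      have h1 := hreg.le_add ha hv.1 hva
      have h2 := hv.2
      rw [le_div_iff₀ (by linarith)]
      linarith
  refine ⟨sSup S, ?_, ?_, ?_⟩
  · obtain ⟨v, hv⟩ := hne
    exact hv.1.1.le.trans (le_csSup hbdd hv)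
  · intro v hlo hv
    obtain ⟨w, hw, hvw⟩ := exists_lt_of_lt_csSup hne hv
    have hvI : v ∈ typeInterior lo hi := ⟨hlo, (EReal.coe_lt_coe_iff.2 hvw).trans hw.1.2⟩
    refine ⟨hvI, ?_⟩
    have h1 := hreg.le_add hvI hw.1 hvw.le
    have h2 := hw.2
    nlinarith
  · intro v hv hqv
    by_contra hc
    exact hqv.not_ge (le_csSup hbdd ⟨hv, not_le.1 hc⟩)

end IsPrior

/-! ### The tail bound -/

/-- A backward Grönwall inequality in which `K` solves the linear equation `K' = k * K`. -/
theorem mul_le_mul_of_le_add_integral {G k K : ℝ → ℝ} {m q : ℝ} (hmq : m ≤ q)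
    (hG : ContinuousOn G (Set.Icc m q)) (hk : ContinuousOn k (Set.Icc m q))
    (hk0 : ∀ v ∈ Set.Icc m q, 0 ≤ k v) (hK0 : ∀ v ∈ Set.Icc m q, 0 ≤ K v)
    (hKc : ContinuousOn K (Set.Icc m q))
    (hK : ∀ v ∈ Set.Ioo m q, HasDerivAt K (k v * K v) v)
    (h : ∀ v ∈ Set.Icc m q, G v ≤ G q + ∫ s in v..q, k s * G s) :
    G m * K m ≤ G q * K q := by
  set H : ℝ → ℝ := fun v => G q + ∫ s in v..q, k s * G s with hH
  have hkG : ContinuousOn (fun s => k s * G s) (Set.Icc m q) := hk.mul hG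
  have hint : IntervalIntegrable (fun s => k s * G s) volume m q := by
    rw [← Set.uIcc_of_le hmq] at hkG
    exact hkG.intervalIntegrable
  have hHd : ∀ v ∈ Set.Ioo m q, HasDerivAt H (-(k v * G v)) v := by
    intro v hv
    have hnhds : Set.Icc m q ∈ nhds v := Icc_mem_nhds hv.1 hv.2
    refine (intervalIntegral.integral_hasDerivAt_left ?_ ?_ (hkG.continuousAt hnhds)).const_add _
    · exact hint.mono_set (by
        rw [Set.uIcc_of_le hmq, Set.uIcc_of_le hv.2.le]
        exact Set.Icc_subset_Icc_left hv.1.le)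
    · exact (hkG.mono Set.Ioo_subset_Icc_self).stronglyMeasurableAtFilter isOpen_Ioo v hv
  have hHc : ContinuousOn H (Set.Icc m q) := by
    refine continuousOn_const.add ?_
    have := intervalIntegral.continuousOn_primitive_interval_left
      (f := fun s => k s * G s) (μ := volume) (a := m) (b := q) (by
        rw [Set.uIcc_of_le hmq]; exact hkG.integrableOn_Icc)
    rwa [Set.uIcc_of_le hmq] at this
  -- The derivative of `H * K` is `k * K * (H - G)`, and `H` majorizes `G` by hypothesis.
  have hmono : MonotoneOn (fun v => H v * K v) (Set.Icc m q) := by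
    refine monotoneOn_of_hasDerivWithinAt_nonneg
      (f' := fun v => -(k v * G v) * K v + H v * (k v * K v))
      (convex_Icc m q) (hHc.mul hKc) ?_ ?_
    · intro v hv
      rw [interior_Icc] at hv
      exact ((hHd v hv).mul (hK v hv)).hasDerivWithinAt
    · intro v hv
      rw [interior_Icc] at hv
      have hv' := Set.Ioo_subset_Icc_self hv
      have h1 : 0 ≤ (H v - G v) * (k v * K v) :=
        mul_nonneg (sub_nonneg.2 (h v hv')) (mul_nonneg (hk0 v hv') (hK0 v hv'))
      linarith
  have hm := Set.left_mem_Icc.2 hmq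
  have hHq : H q = G q := by simp [hH]
  calc G m * K m ≤ H m * K m := mul_le_mul_of_nonneg_right (h m hm) (hK0 m hm)
    _ ≤ H q * K q := hmono hm (Set.right_mem_Icc.2 hmq) hmq
    _ = G q * K q := by rw [hHq]

theorem c_le_one {lam : ℝ} (h0 : 0 ≤ lam) (h1 : lam < 1) : c lam ≤ 1 := by
  unfold c
  split_ifs with h
  · rw [div_le_one (Real.exp_pos _)]
    exact Real.one_le_exp zero_le_one
  · exact Real.rpow_le_one (by linarith) (by linarith) (by positivity)

/-- A positive solution of `K' = K / ((1 - lam) * d + lam * (v - p))` on `[p, p + d]`. -/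
theorem exists_solution {lam p d : ℝ} (h0 : 0 ≤ lam) (h1 : lam < 1) (hd : 0 < d) :
    ∃ K : ℝ → ℝ, (∀ v, p ≤ v →
        0 < K v ∧ HasDerivAt K (((1 - lam) * d + lam * (v - p))⁻¹ * K v) v) ∧
      MonotoneOn K (Set.Ici p) ∧ K p = c lam * K (p + d) := by
  rcases h0.eq_or_lt with rfl | h0
  · refine ⟨fun v => Real.exp ((v - p) / d), ?_, ?_, ?_⟩
    · intro v _
      refine ⟨Real.exp_pos _, ?_⟩
      have : HasDerivAt (fun v => (v - p) / d) (1 / d) v :=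
        ((hasDerivAt_id v).sub_const p).div_const d
      convert this.exp using 1
      simp [mul_comm]
    · intro a _ b _ hab
      simp only
      gcongr
    · simp [c, hd.ne']
  · have hpos : ∀ v, p ≤ v → 0 < (1 - lam) * d + lam * (v - p) := by
      intro v hv
      have := mul_pos (sub_pos.2 h1) hd
      have := mul_nonneg h0.le (sub_nonneg.2 hv)
      linarith
    refine ⟨fun v => ((1 - lam) * d + lam * (v - p)) ^ (1 / lam), ?_, ?_, ?_⟩
    · intro v hv
      have hv' := hpos v hv
      refine ⟨Real.rpow_pos_of_pos hv' _, ?_⟩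
      have : HasDerivAt (fun v => (1 - lam) * d + lam * (v - p)) (lam * 1) v :=
        (((hasDerivAt_id v).sub_const p).const_mul lam).const_add _
      convert this.rpow_const (p := 1 / lam) (Or.inl hv'.ne') using 1
      rw [Real.rpow_sub_one hv'.ne']
      field_simp
    · intro a ha b hb hab
      have := hpos a ha
      simp only
      gcongr
    -- The base of the power is `(1 - lam) * d` at `p` and `d` at `p + d`; the ratio of the powers
    -- is `c lam`.
    · simp only [c, h0.ne', if_false]
      rw [← Real.mul_rpow (by linarith) (by nlinarith)]
      congr 1
      ring

namespace IsPrior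

variable {μ : Measure ℝ} {f : ℝ → ℝ} {lo : ℝ} {hi : EReal}

/-- If the virtual value stays below `p` up to `q`, then little probability lies in `[p, q)`. -/
theorem c_mul_le [IsProbabilityMeasure μ] (h : IsPrior μ f lo hi) {lam : ℝ}
    (hlam : 0 ≤ lam) (hlam1 : lam < 1) (hreg : IsLambdaRegular lam μ f lo hi) {p q : ℝ}
    (hloq : lo ≤ q) (hpq : p < q)
    (hq : ∀ v, lo < v → v < q → v ∈ typeInterior lo hi ∧ v - invHazard μ f v < p) :
    c lam * μ.real (Set.Ici p) ≤ μ.real (Set.Ici q) := by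
  have := h.noAtoms
  set d := q - p with hd
  have hd0 : 0 < d := sub_pos.2 hpq
  -- The density bound holds only above `lo`, so the comparison starts at `m`; there is no mass
  -- between `p` and `m`.
  set m := max p lo with hm
  have hmq : m ≤ q := max_le hpq.le hloq
  have hpm : p ≤ m := le_max_left _ _
  set k : ℝ → ℝ := fun v => ((1 - lam) * d + lam * (v - p))⁻¹ with hk
  set G : ℝ → ℝ := fun v => μ.real (Set.Ici v) with hG
  have hG0 : ∀ v, 0 ≤ G v := fun v => measureReal_nonneg
  have hG1 : ∀ v, G v ≤ 1 := fun v => measureReal_le_one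
  have hden0 : 0 < (1 - lam) * d := mul_pos (sub_pos.2 hlam1) hd0
  have hden : ∀ v, p ≤ v → (1 - lam) * d ≤ (1 - lam) * d + lam * (v - p) := by
    intro v hv
    have := mul_nonneg hlam (sub_nonneg.2 hv)
    linarith
  have hk0 : ∀ v, p ≤ v → 0 ≤ k v := fun v hv => inv_nonneg.2 (hden0.le.trans (hden v hv))
  have hkc : ContinuousOn k (Set.Icc m q) := by
    refine ContinuousOn.inv₀ (by fun_prop) fun v hv => ?_
    exact (hden0.trans_le (hden v (hpm.trans hv.1))).ne'
  -- Otherwise the slope bound would push the virtual value above `p` at some `w < q`.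
  have hhaz : ∀ v, lo < v → v < q →
      (1 - lam) * d + lam * (v - p) ≤ invHazard μ f v := by
    intro v hv1 hv2
    by_contra hc
    rw [not_le] at hc
    have hw : (invHazard μ f v + p - lam * v) / (1 - lam) < q := by
      rw [div_lt_iff₀ (by linarith)]
      simp only [hd] at hc
      linarith
    obtain ⟨w, hw1, hw2⟩ := exists_between (max_lt hv2 hw)
    have hvw : v < w := (le_max_left _ _).trans_lt hw1
    have h2 := (le_max_right _ _).trans_lt hw1
    rw [div_lt_iff₀ (by linarith)] at h2
    obtain ⟨hwI, hwp⟩ := hq w (hv1.trans hvw) hw2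
    have h3 := hreg.le_add (hq v hv1 hv2).1 hwI hvw.le
    linarith
  have hfk : ∀ v, p ≤ v → lo < v → v < q → f v ≤ k v * G v := by
    intro v hv0 hv1 hv2
    have hvI := (hq v hv1 hv2).1
    have hf := h.density_pos v hvI
    have e1 : G v = f v * invHazard μ f v := by
      simp only [hG]
      rw [invHazard, mul_div_cancel₀ _ hf.ne', h.one_sub_cdf]
    have hpos := hden0.trans_le (hden v hv0)
    rw [e1, hk]
    simp only
    rw [inv_mul_eq_div, le_div_iff₀ hpos]
    gcongr
    exact hhaz v hv1 hv2
  have hanti : ∀ a b, a ≤ b → G b ≤ G a := fun a b hab =>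
    measureReal_mono (Set.Ici_subset_Ici.2 hab)
  have hdiff : ∀ a b, a ≤ b → ENNReal.ofReal (G a - G b)
      = ∫⁻ v in Set.Ioo a b, ENNReal.ofReal (f v) := by
    intro a b hab
    have e : G a - G b = μ.real (Set.Ioo a b) := by
      rw [measureReal_congr (Ioo_ae_eq_Ico (μ := μ)), ← Set.Ici_sdiff_Ici,
        measureReal_sdiff (Set.Ici_subset_Ici.2 hab) measurableSet_Ici]
    rw [e, ofReal_measureReal]
    conv_lhs => rw [h.eq_withDensity]
    rw [withDensity_apply _ measurableSet_Ioo]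
  have hbound : ∀ a b, m ≤ a → a ≤ b → b ≤ q → ∀ v ∈ Set.Ioo a b, f v ≤ k v * G v :=
    fun a b ha _ hb v hv => hfk v ((hpm.trans ha).trans hv.1.le)
      ((le_max_right p lo).trans_lt (lt_of_le_of_lt ha hv.1)) (hv.2.trans_le hb)
  -- On this range the density is at most `k * G ≤ B`, so the tail is Lipschitz.
  have hGc : ContinuousOn G (Set.Icc m q) := by
    set B := ((1 - lam) * d)⁻¹ with hB
    have hB0 : 0 ≤ B := inv_nonneg.2 hden0.le
    have key : ∀ a b, m ≤ a → a ≤ b → b ≤ q → G a - G b ≤ B * (b - a) := by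
      intro a b ha hab hb
      rw [← ENNReal.ofReal_le_ofReal_iff (mul_nonneg hB0 (sub_nonneg.2 hab)), hdiff a b hab,
        ENNReal.ofReal_mul hB0, ← Real.volume_Ioo, ← setLIntegral_const]
      refine setLIntegral_mono' measurableSet_Ioo fun v hv => ?_
      refine ENNReal.ofReal_le_ofReal ((hbound a b ha hab hb v hv).trans ?_)
      have hpv : p ≤ v := (hpm.trans ha).trans hv.1.le
      calc k v * G v ≤ k v * 1 := mul_le_mul_of_nonneg_left (hG1 v) (hk0 v hpv)
        _ ≤ B := by
          rw [mul_one]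
          exact inv_anti₀ hden0 (hden v hpv)
    have hL : LipschitzOnWith (Real.toNNReal B) G (Set.Icc m q) := by
      refine LipschitzOnWith.of_dist_le_mul fun x hx y hy => ?_
      rw [Real.dist_eq, Real.dist_eq, Real.coe_toNNReal _ hB0]
      rcases le_total x y with hxy | hxy
      · rw [abs_of_nonneg (sub_nonneg.2 (hanti x y hxy)), abs_sub_comm x y,
          abs_of_nonneg (sub_nonneg.2 hxy)]
        exact key x y hx.1 hxy hy.2
      · rw [abs_sub_comm, abs_of_nonneg (sub_nonneg.2 (hanti y x hxy)),
          abs_of_nonneg (sub_nonneg.2 hxy)]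
        exact key y x hy.1 hxy hx.2
    exact hL.continuousOn
  obtain ⟨K, hK, hKmono, hKp⟩ := exists_solution (p := p) hlam hlam1 hd0
  rw [show p + d = q by simp [hd]] at hKp
  have hmain : G m * K m ≤ G q * K q := by
    refine mul_le_mul_of_le_add_integral (k := k) hmq hGc hkc
      (fun v hv => hk0 v (hpm.trans hv.1)) (fun v hv => (hK v (hpm.trans hv.1)).1.le)
      (fun v hv => (hK v (hpm.trans hv.1)).2.continuousAt.continuousWithinAt)
      (fun v hv => (hK v (hpm.trans hv.1.le)).2) fun v hv => ?_
    have hkG0 : ∀ s ∈ Set.Ioc v q, 0 ≤ k s * G s := fun s hs =>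
      mul_nonneg (hk0 s ((hpm.trans hv.1).trans hs.1.le)) (hG0 s)
    have hI0 : 0 ≤ ∫ s in v..q, k s * G s := by
      rw [intervalIntegral.integral_of_le hv.2]
      exact setIntegral_nonneg measurableSet_Ioc hkG0
    rw [← sub_le_iff_le_add', ← ENNReal.ofReal_le_ofReal_iff hI0, hdiff v q hv.2,
      intervalIntegral.integral_of_le hv.2, ofReal_integral_eq_lintegral_ofReal,
      restrict_Ioo_eq_restrict_Ioc]
    · rw [← restrict_Ioo_eq_restrict_Ioc]
      refine setLIntegral_mono' measurableSet_Ioo fun s hs => ?_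
      exact ENNReal.ofReal_le_ofReal (hbound v q hv.1 hv.2 le_rfl s hs)
    · exact (((hkc.mul hGc).mono (Set.Icc_subset_Icc_left hv.1)).integrableOn_Icc).mono_set
        Set.Ioc_subset_Icc_self
    · filter_upwards [ae_restrict_mem measurableSet_Ioc] with s hs using hkG0 s hs
  have hGp : G p = G m := by
    refine measureReal_congr ?_
    filter_upwards [h.ae_mem_typeInterior] with v hv
    have hv1 := hv.1
    refine propext ⟨fun hp => max_le hp hv1.le, fun hp => hpm.trans hp⟩
  have hKq : 0 < K q := (hK q hpq.le).1
  refine le_of_mul_le_mul_right ?_ hKq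
  calc c lam * G p * K q = G m * K p := by rw [hKp, hGp]; ring
    _ ≤ G m * K m := by
      gcongr
      exact hKmono Set.self_mem_Ici hpm hpm
    _ ≤ G q * K q := hmain

end IsPrior

/-! ### Reduction to interim quantities -/

theorem measurable_update_uncurry {ι : Type*} [DecidableEq ι] (i : ι) :
    Measurable (fun z : ℝ × (ι → ℝ) => Function.update z.2 i z.1) := by
  refine measurable_pi_lambda _ fun j => ?_
  by_cases hj : j = i
  · subst hj
    simpa using measurable_fst
  · simp only [Function.update_of_ne hj]
    fun_prop

theorem IsPrior.ae_valuationLaw {ι : Type*} [Fintype ι] {μ : Measure ℝ} [IsProbabilityMeasure μ]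
    {f : ℝ → ℝ} {lo : ℝ} {hi : EReal} (h : IsPrior μ f lo hi) :
    ∀ᵐ w ∂(valuationLaw ι μ), ∀ j, w j ∈ typeSpace lo hi := by
  rw [ae_all_iff]
  intro j
  exact (Measure.quasiMeasurePreserving_eval (μ := fun _ : ι => μ) j).ae
    (h.ae_mem_typeInterior.mono fun v hv => typeInterior_subset_typeSpace lo hi hv)

instance {ι : Type*} [Fintype ι] (μ : Measure ℝ) [IsProbabilityMeasure μ] :
    IsProbabilityMeasure (valuationLaw ι μ) := by
  unfold valuationLaw
  infer_instance

section Interim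

variable {ι : Type*} [Fintype ι] [DecidableEq ι]

/-- Redrawing one coordinate independently does not change the joint law. -/
theorem measurePreserving_update (μ : Measure ℝ) [IsProbabilityMeasure μ] (i : ι) :
    MeasurePreserving (fun z : ℝ × (ι → ℝ) => Function.update z.2 i z.1)
      (μ.prod (valuationLaw ι μ)) (valuationLaw ι μ) := by
  refine ⟨measurable_update_uncurry i, ?_⟩
  refine (Measure.pi_eq fun s hs => ?_).symm
  rw [Measure.map_apply (measurable_update_uncurry i) (MeasurableSet.univ_pi hs)]
  have hpre : (fun z : ℝ × (ι → ℝ) => Function.update z.2 i z.1) ⁻¹' Set.univ.pi s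
      = s i ×ˢ Set.univ.pi (Function.update s i Set.univ) := by
    ext z
    simp only [Set.mem_preimage, Set.mem_prod, Set.mem_univ_pi]
    constructor
    · intro h
      refine ⟨by simpa using h i, fun j => ?_⟩
      by_cases hj : j = i
      · subst hj; simp
      · simpa [hj] using h j
    · rintro ⟨h1, h2⟩ j
      by_cases hj : j = i
      · subst hj; simpa using h1
      · simpa [hj] using h2 j
  rw [hpre, Measure.prod_prod, valuationLaw, Measure.pi_pi,
    ← Finset.mul_prod_erase Finset.univ _ (Finset.mem_univ i),
    ← Finset.mul_prod_erase Finset.univ (fun j => μ (s j)) (Finset.mem_univ i)]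
  simp only [Function.update_self, measure_univ, one_mul]
  congr 1
  refine Finset.prod_congr rfl fun j hj => ?_
  rw [Function.update_of_ne (Finset.ne_of_mem_erase hj)]

/-- Fubini after redrawing coordinate `i`: an ex-ante expectation is the mean of the interim
expectations given the report of `i`. -/
theorem integral_update (μ : Measure ℝ) [IsProbabilityMeasure μ] (i : ι) {g : (ι → ℝ) → ℝ}
    (hg : Integrable g (valuationLaw ι μ)) :
    ∫ v, g v ∂(valuationLaw ι μ)
      = ∫ r, (∫ w, g (Function.update w i r) ∂(valuationLaw ι μ)) ∂μ := by
  have hmp := measurePreserving_update μ i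
  have hg' : Integrable g (Measure.map (fun z : ℝ × (ι → ℝ) => Function.update z.2 i z.1)
      (μ.prod (valuationLaw ι μ))) := by rwa [hmp.map_eq]
  conv_lhs => rw [← hmp.map_eq]
  rw [integral_map hmp.measurable.aemeasurable hg'.aestronglyMeasurable]
  exact integral_prod _ (hmp.integrable_comp_of_integrable hg)

theorem measurable_integral_update (μ : Measure ℝ) [IsProbabilityMeasure μ] (i : ι)
    {g : (ι → ℝ) → ℝ} (hg : Measurable g) :
    Measurable (fun r => ∫ w, g (Function.update w i r) ∂(valuationLaw ι μ)) :=
  ((hg.comp (measurable_update_uncurry i)).stronglyMeasurable.integral_prod_right').measurable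

/-- The probability that buyer `i` gets an item when reporting `r`. -/
noncomputable def interimAlloc (μ : Measure ℝ) (M : Mechanism ι) (i : ι) (r : ℝ) : ℝ :=
  ∫ w, M.alloc (Function.update w i r) i ∂(valuationLaw ι μ)

/-- The expected payment of buyer `i` when reporting `r`. -/
noncomputable def interimPay (μ : Measure ℝ) (M : Mechanism ι) (i : ι) (r : ℝ) : ℝ :=
  ∫ w, M.pay (Function.update w i r) i ∂(valuationLaw ι μ)

namespace IsFeasible

variable {μ : Measure ℝ} [IsProbabilityMeasure μ] {f : ℝ → ℝ} {lo : ℝ} {hi : EReal}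
  {M : Mechanism ι}

theorem integrable_alloc (hM : IsFeasible μ lo hi M) (h : IsPrior μ f lo hi) (i : ι) :
    Integrable (fun v => M.alloc v i) (valuationLaw ι μ) := by
  refine Integrable.of_mem_Icc 0 1 (hM.measurable_alloc i).aemeasurable ?_
  filter_upwards [h.ae_valuationLaw] with w hw using hM.alloc_mem w hw i

theorem ae_alloc_update_mem (hM : IsFeasible μ lo hi M) (h : IsPrior μ f lo hi) (i : ι) {r : ℝ}
    (hr : r ∈ typeSpace lo hi) :
    ∀ᵐ w ∂(valuationLaw ι μ), M.alloc (Function.update w i r) i ∈ Set.Icc (0 : ℝ) 1 := by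
  filter_upwards [h.ae_valuationLaw] with w hw
  refine hM.alloc_mem _ (fun j => ?_) i
  by_cases hj : j = i
  · subst hj; simpa using hr
  · simpa [hj] using hw j

theorem integrable_alloc_update (hM : IsFeasible μ lo hi M) (h : IsPrior μ f lo hi) (i : ι)
    {r : ℝ} (hr : r ∈ typeSpace lo hi) :
    Integrable (fun w => M.alloc (Function.update w i r) i) (valuationLaw ι μ) :=
  Integrable.of_mem_Icc 0 1
    ((hM.measurable_alloc i).comp (measurable_update_left)).aemeasurable
    (hM.ae_alloc_update_mem h i hr)

theorem interimAlloc_mem (hM : IsFeasible μ lo hi M) (h : IsPrior μ f lo hi) (i : ι) {r : ℝ}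
    (hr : r ∈ typeSpace lo hi) : interimAlloc μ M i r ∈ Set.Icc (0 : ℝ) 1 := by
  have hae := hM.ae_alloc_update_mem h i hr
  refine ⟨integral_nonneg_of_ae (hae.mono fun w hw => hw.1), ?_⟩
  calc interimAlloc μ M i r ≤ ∫ _, (1 : ℝ) ∂(valuationLaw ι μ) :=
        integral_mono_ae (hM.integrable_alloc_update h i hr) (integrable_const _)
          (hae.mono fun w hw => hw.2)
    _ = 1 := by simp

theorem interimUtility_eq (hM : IsFeasible μ lo hi M) (h : IsPrior μ f lo hi) (i : ι) (v : ℝ)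
    {r : ℝ} (hr : r ∈ typeSpace lo hi) :
    interimUtility μ M i v r = v * interimAlloc μ M i r - interimPay μ M i r := by
  unfold interimUtility interimAlloc interimPay
  rw [integral_sub ((hM.integrable_alloc_update h i hr).const_mul v)
    (hM.integrable_interim_pay i r hr), integral_const_mul]

theorem profit_eq_sum (hM : IsFeasible μ lo hi M) (h : IsPrior μ f lo hi) (p : ℝ) :
    profit μ p M = ∑ i, ∫ r, (interimPay μ M i r - p * interimAlloc μ M i r) ∂μ := by
  have hi : ∀ i, Integrable (fun v => M.pay v i - p * M.alloc v i) (valuationLaw ι μ) :=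
    fun i => (hM.integrable_pay i).sub ((hM.integrable_alloc h i).const_mul p)
  unfold profit
  rw [integral_finsetSum _ fun i _ => hi i]
  refine Finset.sum_congr rfl fun i _ => ?_
  rw [integral_update μ i (hi i)]
  refine integral_congr_ae ?_
  filter_upwards [h.ae_mem_typeInterior] with r hr
  have hr' := typeInterior_subset_typeSpace _ _ hr
  unfold interimPay interimAlloc
  rw [integral_sub (hM.integrable_interim_pay i r hr')
    ((hM.integrable_alloc_update h i hr').const_mul p), integral_const_mul]

/-- The profit of a feasible mechanism is its virtual surplus, net of the buyers' lowest utilities. -/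
theorem profit_eq (hM : IsFeasible μ lo hi M) (h : IsPrior μ f lo hi) {lam : ℝ}
    (hlam : 0 ≤ lam) (hlam1 : lam < 1) (hreg : IsLambdaRegular lam μ f lo hi) (p : ℝ) :
    profit μ p M = ∑ i, (∫ v, (v - invHazard μ f v - p) * interimAlloc μ M i v ∂μ
      - interimUtility μ M i lo lo) := by
  rw [hM.profit_eq_sum h]
  refine Finset.sum_congr rfl fun i _ => ?_
  rw [hM.interimUtility_eq h i lo h.lo_mem]
  refine h.integral_profit_eq hlam hlam1 hreg
    (X := interimAlloc μ M i) (T := interimPay μ M i)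
    (measurable_integral_update μ i (hM.measurable_alloc i))
    (measurable_integral_update μ i (hM.measurable_pay i))
    (fun v hv => hM.interimAlloc_mem h i hv) (fun v hv r hr => ?_) p
  rw [← hM.interimUtility_eq h i v hr, ← hM.interimUtility_eq h i v hv]
  exact hM.incentive_compatible i v hv r hr

/-- The event depends only on coordinate `i`, so it passes through the inner integral. -/
theorem setIntegral_alloc (hM : IsFeasible μ lo hi M) (h : IsPrior μ f lo hi) (p : ℝ) (i : ι) :
    ∫ v in {v | p ≤ v i}, M.alloc v i ∂(valuationLaw ι μ)
      = ∫ r in Set.Ici p, interimAlloc μ M i r ∂μ := by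
  have hS : MeasurableSet {v : ι → ℝ | p ≤ v i} :=
    measurableSet_le measurable_const (measurable_pi_apply i)
  rw [← integral_indicator hS,
    integral_update μ i ((hM.integrable_alloc h i).indicator hS),
    ← integral_indicator measurableSet_Ici]
  congr 1 with r
  by_cases hr : p ≤ r <;> simp [Set.indicator, hr, interimAlloc]

end IsFeasible

/-! ### Posted prices and optimality -/

/-- The mechanism that offers every buyer the price `q`. -/
noncomputable def postedPrice (ι : Type*) (q : ℝ) : Mechanism ι where
  alloc v i := if q ≤ v i then 1 else 0
  pay v i := if q ≤ v i then q else 0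

theorem interimAlloc_postedPrice (μ : Measure ℝ) [IsProbabilityMeasure μ] (q : ℝ) (i : ι)
    (r : ℝ) : interimAlloc μ (postedPrice ι q) i r = if q ≤ r then 1 else 0 := by
  simp [interimAlloc, postedPrice]

theorem interimUtility_postedPrice (μ : Measure ℝ) [IsProbabilityMeasure μ] (q : ℝ) (i : ι)
    (v r : ℝ) : interimUtility μ (postedPrice ι q) i v r = if q ≤ r then v - q else 0 := by
  by_cases h : q ≤ r <;> simp [interimUtility, postedPrice, h]

theorem isFeasible_postedPrice (μ : Measure ℝ) [IsProbabilityMeasure μ] (lo : ℝ) (hi : EReal)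
    (q : ℝ) : IsFeasible μ lo hi (postedPrice ι q) where
  measurable_alloc i := Measurable.ite
    (measurableSet_le measurable_const (measurable_pi_apply i)) measurable_const measurable_const
  measurable_pay i := Measurable.ite
    (measurableSet_le measurable_const (measurable_pi_apply i)) measurable_const measurable_const
  alloc_mem v _ i := by
    simp only [postedPrice]
    split_ifs <;> simp
  integrable_pay i := by
    refine Integrable.of_bound (C := |q|) (Measurable.ite (measurableSet_le measurable_const
      (measurable_pi_apply i)) measurable_const measurable_const).aestronglyMeasurable ?_
    refine Filter.Eventually.of_forall fun v => ?_
    simp only [postedPrice]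
    split_ifs <;> simp
  integrable_interim_pay i r _ := by simp [postedPrice]
  incentive_compatible i v _ r _ := by
    rw [interimUtility_postedPrice, interimUtility_postedPrice]
    split_ifs <;> linarith
  individually_rational i v _ := by
    rw [interimUtility_postedPrice]
    split_ifs <;> linarith

end Interim

namespace IsPrior

variable {μ : Measure ℝ} {f : ℝ → ℝ} {lo : ℝ} {hi : EReal}

/-- Selling at the cutoff maximizes the virtual surplus pointwise. -/
theorem ae_virtual_surplus_le (h : IsPrior μ f lo hi) {p q : ℝ}
    (hq1 : ∀ v, lo < v → v < q → v ∈ typeInterior lo hi ∧ v - invHazard μ f v < p)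
    (hq2 : ∀ v ∈ typeInterior lo hi, q < v → p ≤ v - invHazard μ f v) {X : ℝ → ℝ}
    (hX01 : ∀ v ∈ typeSpace lo hi, X v ∈ Set.Icc (0 : ℝ) 1) :
    ∀ᵐ v ∂μ, (v - invHazard μ f v - p) * X v
      ≤ (v - invHazard μ f v - p) * (if q ≤ v then 1 else 0) := by
  have := h.noAtoms
  filter_upwards [h.ae_mem_typeInterior, compl_mem_ae_iff.2 (measure_singleton q)] with v hv hvq
  have hX := hX01 v (typeInterior_subset_typeSpace lo hi hv)
  rcases lt_or_gt_of_ne hvq with hlt | hgt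
  · rw [if_neg hlt.not_ge, mul_zero]
    exact mul_nonpos_of_nonpos_of_nonneg (by linarith [(hq1 v hv.1 hlt).2]) hX.1
  · rw [if_pos (le_of_lt hgt)]
    exact mul_le_mul_of_nonneg_left hX.2 (by linarith [hq2 v hv hgt])

/-- The slope bound with `lam < 1` makes the virtual value strictly increasing, so it equals `p` at
most once, and the prior has no atoms. This forces uniqueness of the optimal interim allocation. -/
theorem ae_virtual_ne (h : IsPrior μ f lo hi) {lam : ℝ} (hlam1 : lam < 1)
    (hreg : IsLambdaRegular lam μ f lo hi) (p : ℝ) :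
    ∀ᵐ v ∂μ, v - invHazard μ f v - p ≠ 0 := by
  have := h.noAtoms
  have hsub : {v | v ∈ typeInterior lo hi ∧ v - invHazard μ f v - p = 0}.Subsingleton := by
    have key : ∀ a ∈ typeInterior lo hi, ∀ b ∈ typeInterior lo hi, a < b →
        a - invHazard μ f a < b - invHazard μ f b := by
      intro a ha b hb hab
      have := hreg.le_add ha hb hab.le
      nlinarith
    rintro a ⟨ha, ha0⟩ b ⟨hb, hb0⟩
    rcases lt_trichotomy a b with hab | hab | hab
    · linarith [key a ha b hb hab]
    · exact hab
    · linarith [key b hb a ha hab]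
  filter_upwards [h.ae_mem_typeInterior, compl_mem_ae_iff.2 (hsub.measure_zero μ)] with v hv hv'
  exact fun h0 => hv' ⟨hv, h0⟩

end IsPrior

end Intermediary

theorem mainTheorem6 {ι : Type*} [Fintype ι] [DecidableEq ι]
    (μ : MeasureTheory.Measure ℝ) [MeasureTheory.IsProbabilityMeasure μ]
    (f : ℝ → ℝ) (lo : ℝ) (hi : EReal) (hprior : Intermediary.IsPrior μ f lo hi)
    (lam : ℝ) (hlam_nonneg : 0 ≤ lam) (hlam_lt_one : lam < 1)
    (hreg : Intermediary.IsLambdaRegular lam μ f lo hi)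
    (p : ℝ) (hp : 0 ≤ p) :
    (∃ M : Intermediary.Mechanism ι, Intermediary.IsProfitMaximizing μ lo hi p M) ∧
    ∀ M : Intermediary.Mechanism ι, Intermediary.IsProfitMaximizing μ lo hi p M →
      ∀ i : ι, Intermediary.valuationLaw ι μ {v | p ≤ v i} ≠ 0 →
        Intermediary.c lam ≤ Intermediary.condBuyProb μ p M i := by
  open Intermediary in
  obtain ⟨q, hloq, hq1, hq2⟩ := hprior.exists_cutoff hlam_lt_one hreg p
  set X₀ : ℝ → ℝ := fun v => if q ≤ v then 1 else 0 with hX₀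
  have hX₀m : Measurable X₀ := Measurable.ite measurableSet_Ici measurable_const measurable_const
  have hX₀i := hprior.integrable_virtual_mul hlam_nonneg hlam_lt_one hreg (X := X₀) hX₀m
    (fun v _ => by simp only [hX₀]; split_ifs <;> simp) p
  have hXi : ∀ M : Mechanism ι, IsFeasible μ lo hi M → ∀ i,
      Integrable (fun v => (v - invHazard μ f v - p) * interimAlloc μ M i v) μ := fun M hM i =>
    hprior.integrable_virtual_mul hlam_nonneg hlam_lt_one hreg
      (measurable_integral_update μ i (hM.measurable_alloc i))
      (fun v hv => hM.interimAlloc_mem hprior i hv) p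
  have hae : ∀ M : Mechanism ι, IsFeasible μ lo hi M → ∀ i,
      ∀ᵐ v ∂μ, (v - invHazard μ f v - p) * interimAlloc μ M i v
        ≤ (v - invHazard μ f v - p) * X₀ v := fun M hM i =>
    hprior.ae_virtual_surplus_le hq1 hq2 fun v hv => hM.interimAlloc_mem hprior i hv
  set A := ∫ v, (v - invHazard μ f v - p) * X₀ v ∂μ with hA
  have hterm : ∀ M : Mechanism ι, IsFeasible μ lo hi M → ∀ i,
      ∫ v, (v - invHazard μ f v - p) * interimAlloc μ M i v ∂μ
        - interimUtility μ M i lo lo ≤ A := fun M hM i =>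
    (sub_le_self _ (hM.individually_rational i lo hprior.lo_mem)).trans
      (integral_mono_ae (hXi M hM i) hX₀i (hae M hM i))
  have hfeas := isFeasible_postedPrice (ι := ι) μ lo hi q
  have hposted : profit μ p (postedPrice ι q) = ∑ _i : ι, A := by
    rw [hfeas.profit_eq hprior hlam_nonneg hlam_lt_one hreg]
    refine Finset.sum_congr rfl fun i _ => ?_
    -- Since `lo ≤ q`, the lowest type buys only if `q = lo`, and then at zero surplus.
    have hu : interimUtility μ (postedPrice ι q) i lo lo = 0 := by
      rw [interimUtility_postedPrice]
      split_ifs with hqlo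
      · linarith
      · rfl
    simp_rw [hu, interimAlloc_postedPrice, sub_zero]
    rfl
  refine ⟨⟨postedPrice ι q, hfeas, fun M hM => ?_⟩, ?_⟩
  · rw [hposted, hM.profit_eq hprior hlam_nonneg hlam_lt_one hreg]
    exact Finset.sum_le_sum fun i _ => hterm M hM i
  rintro M ⟨hM, hopt⟩ i hpi
  have hsum := hopt _ hfeas
  rw [hposted, hM.profit_eq hprior hlam_nonneg hlam_lt_one hreg] at hsum
  -- Every buyer contributes at most `A` and the optimum totals at least `A` per buyer, so no buyer
  -- can fall short.
  have hAi : A ≤ ∫ v, (v - invHazard μ f v - p) * interimAlloc μ M i v ∂μ := by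
    by_contra hlt
    refine hsum.not_gt (Finset.sum_lt_sum (fun j _ => hterm M hM j) ⟨i, Finset.mem_univ i, ?_⟩)
    exact (sub_le_self _ (hM.individually_rational i lo hprior.lo_mem)).trans_lt (not_le.1 hlt)
  -- Equal integrals of ordered functions force equality almost everywhere; the virtual factor is
  -- almost surely nonzero and cancels.
  have hXeq : ∀ᵐ v ∂μ, interimAlloc μ M i v = X₀ v := by
    have h1 := (integral_eq_iff_of_ae_le (hXi M hM i) hX₀i (hae M hM i)).1
      (le_antisymm (integral_mono_ae (hXi M hM i) hX₀i (hae M hM i)) hAi)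
    filter_upwards [h1, hprior.ae_virtual_ne hlam_lt_one hreg p] with v h1 h2
    exact mul_left_cancel₀ h2 h1
  have hlaw : valuationLaw ι μ {v | p ≤ v i} = μ (Set.Ici p) :=
    (measurePreserving_eval (fun _ : ι => μ) i).measure_preimage
      measurableSet_Ici.nullMeasurableSet
  rw [hlaw] at hpi
  have hpos : 0 < μ.real (Set.Ici p) := ENNReal.toReal_pos hpi (measure_ne_top _ _)
  have hval : condBuyProb μ p M i = (μ.real (Set.Ici p))⁻¹ * μ.real (Set.Ici (max p q)) := by
    unfold condBuyProb
    rw [ProbabilityTheory.cond, integral_smul_measure, hlaw, ENNReal.toReal_inv, smul_eq_mul,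
      hM.setIntegral_alloc hprior, integral_congr_ae (ae_restrict_of_ae hXeq)]
    have hind : X₀ = (Set.Ici q).indicator 1 := by
      ext v
      simp [hX₀, Set.indicator]
    rw [hind, integral_indicator_one measurableSet_Ici, measureReal_restrict_apply measurableSet_Ici,
      Set.Ici_inter_Ici, max_comm]
    rfl
  rw [hval, inv_mul_eq_div, le_div_iff₀ hpos]
  rcases lt_or_ge p q with hpq | hqp
  · rw [max_eq_right hpq.le]
    exact hprior.c_mul_le hlam_nonneg hlam_lt_one hreg hloq hpq hq1
  · rw [max_eq_left hqp]
    exact mul_le_of_le_one_left hpos.le (c_le_one hlam_nonneg hlam_lt_one)
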